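/- Let $\mathcal C$ be a braided monoidal category with braiding $\Phi$ and unit object $I$, and let $H$ be a Hopf algebra in $\mathcal C$ with invertible antipode $S$. Assume that $H$ is finite, i.e. has a dual object $H^*$ with evaluation $e\colon H^*\otimes H\to I$ and dual basis $d\colon I\to H\otimes H^*$ satisfying the two triangle identities; put $\bar e=e\,\Phi_{H,H^*}\colon H\otimes H^*\to I$. (We suppress associativity constraints.) An algebra $(A,\nabla)$ is called commutative if $\nabla\Phi_{A,A}=\nabla$, and a coalgebra $(A,\Delta)$ cocommutative if $\Phi_{A,A}\Delta=\Delta$. The algebra and coalgebra structures $\nabla_{H^*}$, $\Delta_{H^*}$ on $H^*$ are determined by $$e(\nabla_{H^*}\otimes H)=(e\otimes e)(H^*\otimes\Phi_{H^*,H}\otimes H)(H^*\otimes H^*\otimes\Delta_H),$$ $$(e\otimes e)(H^*\otimes\Phi_{H^*,H}\otimes H)(\Delta_{H^*}\otimes H\otimes H)=e(H^*\otimes\nabla_H).$$ Let $B=(H^{op})^*$, i.e. the object $H^*$ with $\nabla_B=\nabla_{H^*}$ and with $\Delta_B$ determined by the second formula with $\nabla_H$ replaced by $\nabla_{H^{op}}=\nabla_H\Phi_{H,H}$.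 Let $\triangleright\colon H\otimes B\to B$ be determined by $$\bar e\,(H\otimes\triangleright)=\bar e\,\bigl(\nabla_H\,\Phi_{H,H}\,(\nabla_H\otimes S^{-1})(H\otimes\Delta_H)\otimes B\bigr),$$ and put $$\triangleleft=(H\otimes\bar e)\bigl((H\otimes\nabla_H\Phi_{H,H})(\Phi_{H,H}^{-1}\otimes S^{-1})(\Delta_H\otimes H)\Delta_H\otimes B\bigr)\colon H\otimes B\to H.$$ The Drinfel'd double $D(H)=B\bowtie H$ is the object $B\otimes H$ with multiplication $$(\nabla_B\otimes\nabla_H)\bigl(B\otimes(\triangleright\otimes\triangleleft)(H\otimes\Phi_{H,B}\otimes B)(\Delta_H\otimes\Delta_B)\otimes H\bigr)$$ and comultiplication $(B\otimes\Phi_{B,H}\otimes H)(\Delta_B\otimes\Delta_H)$. Assume that $\Phi_{H,H^*}$ is symmetric, i.e. $\Phi_{H,H^*}=\Phi_{H^*,H}^{-1}$. Then the following are equivalent: (i) $D(H)$ is commutative; (ii) $H$ and $H^*$ are commutative; (iii) $H$ and $H^*$ are cocommutative; (iv) $D(H)$ is cocommutative. -/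

import Mathlib

open CategoryTheory MonoidalCategory

namespace BraidedDouble

open scoped MonObj ComonObj HopfObj

variable {C : Type*} [Category C] [MonoidalCategory C] [BraidedCategory C]

/-- The braiding `Φ_{X,Y}` is symmetric: `Φ_{X,Y} = Φ_{Y,X}⁻¹`. -/
def IsSymmetricBraiding (X Y : C) : Prop :=
  (β_ X Y).hom = (β_ Y X).inv

/-- A multiplication `m` is commutative: `m ∘ Φ_{A,A} = m`. -/
def IsCommutative {A : C} (m : A ⊗ A ⟶ A) : Prop :=
  (β_ A A).hom ≫ m = m

/-- A comultiplication `d` is cocommutative: `Φ_{A,A} ∘ d = d`. -/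
def IsCocommutative {A : C} (d : A ⟶ A ⊗ A) : Prop :=
  d ≫ (β_ A A).hom = d

section Dual

/-! Here `Hd` is a dual `H*` of `H`, given by `e : H* ⊗ H ⟶ I` and `d : I ⟶ H ⊗ H*`
satisfying the two triangle identities, that is, by Mathlib's `ExactPairing H Hd`. -/

variable (H Hd : C) [ExactPairing H Hd]

/-- The evaluation `e : H* ⊗ H ⟶ I`. -/
noncomputable def ev : Hd ⊗ H ⟶ 𝟙_ C :=
  ExactPairing.evaluation H Hd

/-- The opposite evaluation `e' = e ∘ Φ_{H,H*} : H ⊗ H* ⟶ I`. -/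
noncomputable def evOp : H ⊗ Hd ⟶ 𝟙_ C :=
  (β_ H Hd).hom ≫ ev H Hd

variable {H} in
/-- The unique `g : T ⟶ H*` with `e ∘ (g ⊗ H) = f`. -/
noncomputable def toDual {T : C} (f : T ⊗ H ⟶ 𝟙_ C) : T ⟶ Hd :=
  tensorRightHomEquiv T H Hd (𝟙_ C) f ≫ (λ_ Hd).hom

variable {H} in
/-- The unique `g : T ⟶ H*` with `e' ∘ (H ⊗ g) = f`. -/
noncomputable def toDualOp {T : C} (f : H ⊗ T ⟶ 𝟙_ C) : T ⟶ Hd :=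
  letI := BraidedCategory.exactPairing_swap H Hd
  tensorLeftHomEquiv T Hd H (𝟙_ C) f ≫ (ρ_ Hd).hom

/-- `(e ⊗ e) ∘ (H* ⊗ Φ_{H*,H} ⊗ H) : (H* ⊗ H*) ⊗ (H ⊗ H) ⟶ I`. -/
noncomputable def evTwo : (Hd ⊗ Hd) ⊗ (H ⊗ H) ⟶ 𝟙_ C :=
  tensorμ Hd Hd H H ≫ (ev H Hd ⊗ₘ ev H Hd) ≫ (λ_ (𝟙_ C)).hom

variable {H}

/-- The multiplication on `H*` dual to a comultiplication `d` on `H`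
(see `dualMul_spec`). -/
noncomputable def dualMul (d : H ⟶ H ⊗ H) : Hd ⊗ Hd ⟶ Hd :=
  toDual Hd ((Hd ⊗ Hd) ◁ d ≫ evTwo H Hd)

/-- The comultiplication on `H*` dual to a multiplication `m` on `H`
(see `dualComul_spec`): the transpose of `e ∘ (H* ⊗ m)` in both copies of `H`, with the two
factors `H*` braided into the right order. -/
noncomputable def dualComul (m : H ⊗ H ⟶ H) : Hd ⟶ Hd ⊗ Hd :=
  tensorRightHomEquiv Hd H Hd Hd (toDual Hd ((α_ Hd H H).hom ≫ Hd ◁ m ≫ ev H Hd)) ≫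
    (β_ Hd Hd).hom

theorem toDual_spec {T : C} (f : T ⊗ H ⟶ 𝟙_ C) : toDual Hd f ▷ H ≫ ev H Hd = f := by
  refine Eq.trans ?_ ((tensorRightHomEquiv T H Hd (𝟙_ C)).symm_apply_apply f)
  change _ = tensorRightHomEquiv T H Hd (𝟙_ C) f ▷ H ≫ (α_ _ _ _).hom ≫ _ ◁ ev H Hd ≫ (ρ_ _).hom
  rw [toDual]
  monoidal

theorem toDualOp_spec {T : C} (f : H ⊗ T ⟶ 𝟙_ C) : H ◁ toDualOp Hd f ≫ evOp H Hd = f := by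
  let := BraidedCategory.exactPairing_swap H Hd
  refine Eq.trans ?_ ((tensorLeftHomEquiv T Hd H (𝟙_ C)).symm_apply_apply f)
  change _ = H ◁ tensorLeftHomEquiv T Hd H (𝟙_ C) f ≫ (α_ _ _ _).inv ≫ evOp H Hd ▷ _ ≫ (λ_ _).hom
  rw [toDualOp]
  monoidal

/-- `⟨f * g, h⟩ = ⟨f, h₁⟩ ⟨g, h₂⟩`. -/
theorem dualMul_spec (d : H ⟶ H ⊗ H) :
    dualMul Hd d ▷ H ≫ ev H Hd = (Hd ⊗ Hd) ◁ d ≫ evTwo H Hd :=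
  toDual_spec Hd _

variable (H) in
theorem braiding_evTwo :
    (β_ Hd Hd).hom ▷ (H ⊗ H) ≫ evTwo H Hd =
      (α_ Hd Hd (H ⊗ H)).hom ≫ Hd ◁ ((α_ Hd H H).inv ≫ ev H Hd ▷ H ≫ (λ_ H).hom) ≫
        ev H Hd := by
  have key : (α_ Hd Hd H).inv ≫ (β_ Hd Hd).hom ▷ H ≫ (α_ Hd Hd H).hom ≫
      Hd ◁ (β_ Hd H).hom ≫ (α_ Hd H Hd).inv ≫ ev H Hd ▷ Hd ≫ (λ_ Hd).hom =
      Hd ◁ ev H Hd ≫ (ρ_ Hd).hom := by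
    have h := BraidedCategory.braiding_naturality_right Hd (ev H Hd)
    rw [BraidedCategory.braiding_tensor_right_hom] at h
    simp only [Category.assoc] at h
    have h2 := congrArg (· ≫ (λ_ Hd).hom) h
    simp only [Category.assoc, braiding_leftUnitor] at h2
    exact h2.symm
  calc
    _ = 𝟙 _ ⊗≫ ((α_ Hd Hd H).inv ≫ (β_ Hd Hd).hom ▷ H ≫ (α_ Hd Hd H).hom ≫
          Hd ◁ (β_ Hd H).hom ≫ (α_ Hd H Hd).inv ≫ ev H Hd ▷ Hd ≫ (λ_ Hd).hom) ▷ H ⊗≫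
          ev H Hd := by
      simp only [evTwo, tensorμ, MonoidalCategory.tensorHom_def]
      monoidal
    _ = _ := by
      rw [key]
      monoidal

/-- `⟨f₁, h⟩ ⟨f₂, k⟩ = ⟨f, h * k⟩`. -/
theorem dualComul_spec (m : H ⊗ H ⟶ H) :
    dualComul Hd m ▷ (H ⊗ H) ≫ evTwo H Hd = Hd ◁ m ≫ ev H Hd := by
  set F := (α_ Hd H H).hom ≫ Hd ◁ m ≫ ev H Hd with hF
  have h1 := (tensorRightHomEquiv Hd H Hd Hd).symm_apply_apply (toDual Hd F)
  have h2 := toDual_spec Hd F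
  set g := tensorRightHomEquiv Hd H Hd Hd (toDual Hd F) with hg
  have h3 : g ▷ H ≫ (α_ Hd Hd H).hom ≫ Hd ◁ ev H Hd ≫ (ρ_ Hd).hom = toDual Hd F := h1
  have h4 : dualComul Hd m = g ≫ (β_ Hd Hd).hom := rfl
  rw [h4, comp_whiskerRight, Category.assoc, braiding_evTwo]
  calc
    _ = (α_ Hd H H).inv ≫
        (g ▷ H ≫ (α_ Hd Hd H).hom ≫ Hd ◁ ev H Hd ≫ (ρ_ Hd).hom) ▷ H ≫ ev H Hd := by
      monoidal
    _ = _ := by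
      rw [h3, h2, hF]
      simp

end Dual

section Double

variable (H Hd : C) [HopfObj H] [IsIso 𝒮[H]] [ExactPairing H Hd]

/-- The multiplication of `H^op`. -/
noncomputable def opMul : H ⊗ H ⟶ H :=
  (β_ H H).hom ≫ μ[H]

/-! The bialgebra `B = (H^op)*` has underlying object `H*`, multiplication `dualMul Hd Δ[H]`
and comultiplication `dualComul Hd (opMul H)`. -/

/-- The left action `H ⊗ B ⟶ B`, given by
`e'(x ⊗ (h ▷ b)) = e'(S⁻¹(h₂) (x h₁) ⊗ b)`. -/
noncomputable def leftAction : H ⊗ Hd ⟶ Hd :=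
  toDualOp Hd <|
    (α_ H H Hd).inv ≫
      (H ◁ Δ[H] ≫ (α_ H H H).inv ≫ (μ[H] ⊗ₘ inv 𝒮[H]) ≫ (β_ H H).hom ≫ μ[H]) ▷ Hd ≫
      evOp H Hd

/-- The right action `H ⊗ B ⟶ H`, given by
`h ◁ b = h₂ e'(S⁻¹(h₃) h₁ ⊗ b)`. -/
noncomputable def rightAction : H ⊗ Hd ⟶ H :=
  (Δ[H] ≫ (Δ[H] ⊗ₘ inv 𝒮[H]) ≫ (β_ H H).inv ▷ H ≫ (α_ H H H).hom ≫
      H ◁ ((β_ H H).hom ≫ μ[H])) ▷ Hd ≫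
    (α_ H H Hd).hom ≫ H ◁ evOp H Hd ≫ (ρ_ H).hom

/-- The map `H ⊗ B ⟶ B ⊗ H`, `h ⊗ b ↦ (h₁ ▷ b₁) ⊗ (h₂ ◁ b₂)`. -/
noncomputable def doubleCross : H ⊗ Hd ⟶ Hd ⊗ H :=
  (Δ[H] ⊗ₘ dualComul Hd (opMul H)) ≫ tensorμ H H Hd Hd ≫
    (leftAction H Hd ⊗ₘ rightAction H Hd)

/-- The multiplication of the Drinfel'd double `D(H) = B ⋈ H`. -/
noncomputable def doubleMul : (Hd ⊗ H) ⊗ (Hd ⊗ H) ⟶ Hd ⊗ H :=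
  (α_ Hd H (Hd ⊗ H)).hom ≫
    Hd ◁ ((α_ H Hd H).inv ≫ doubleCross H Hd ▷ H ≫ (α_ Hd H H).hom) ≫
    (α_ Hd Hd (H ⊗ H)).inv ≫
    (dualMul Hd Δ[H] ⊗ₘ μ[H])

/-- The (codiagonal) comultiplication of the Drinfel'd double `D(H) = B ⋈ H`. -/
noncomputable def doubleComul : Hd ⊗ H ⟶ (Hd ⊗ H) ⊗ (Hd ⊗ H) :=
  (dualComul Hd (opMul H) ⊗ₘ Δ[H]) ≫ tensorμ Hd Hd H H

end Double

end BraidedDouble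

/-!
All of `H`, `H*` and the double `D(H) = B ⋈ H` are compared through three facts.

*Duality.* Under the symmetry hypothesis the braidings of `H* ⊗ H*` and of `H ⊗ H` are adjoint for
the pairing of `H* ⊗ H*` with `H ⊗ H` (`tensorHom_braiding_evTwo`), and that pairing is
nondegenerate on both sides. Hence the product on `H*` dual to `d` is commutative exactly when `d`
is cocommutative (`isCommutative_dualMul_iff`), and the coproduct on `H*` dual to `m` is
cocommutative exactly when `m` is commutative (`isCocommutative_dualComul_iff`). So (ii) and (iii)
are equivalent.

*Retracts.* `B` and `H` include into `D(H)` by `b ↦ b ⊗ 1` and `h ↦ 1 ⊗ h`, and `D(H)` projects back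
by the counits. Multiplication and comultiplication of both factors are recovered from those of
`D(H)` along these maps (`doubleMul_proj_left`, `doubleMul_proj_right`, `doubleComul_proj_left`,
`doubleComul_proj_right`), so they inherit commutativity and cocommutativity. For the
multiplication this uses that the actions `▷` and `◁` respect units and counits.

*Tensor products.* If `H` and `H*` are commutative, then `H` is also cocommutative and its antipode
is an involution, so `S⁻¹(h₂) h₁` collapses to `ε(h)` and both actions become trivial
(`doubleCross_of_isCommutative`). The double is then the tensor product algebra of `B` and `H`; its
coalgebra is a tensor product in any case. Since `H` and `H*` braid symmetrically, tensor products
inherit commutativity and cocommutativity (`tensorμ_braiding`). The self-braidings of `H` and of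
`H*` enter only through the naturality of the braiding and the (co)commutativity assumptions.
-/

namespace BraidedDouble

open scoped MonObj ComonObj HopfObj

/-! ### The braiding of a tensor product of two pairs -/

section Braiding

variable {C : Type*} [Category C] [MonoidalCategory C] [BraidedCategory C]

/-- The crossing of `X₂` with `Y₁` in `tensorμ` is undone by the one in the braiding of
`X₁ ⊗ Y₁` with `X₂ ⊗ Y₂`; the three remaining crossings are those on the right-hand side. No
assumption on the self-braidings of the factors is needed. -/
theorem tensorμ_braiding (X₁ X₂ Y₁ Y₂ : C) (h : (β_ X₂ Y₁).hom ≫ (β_ Y₁ X₂).hom = 𝟙 _) :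
    tensorμ X₁ X₂ Y₁ Y₂ ≫ (β_ (X₁ ⊗ Y₁) (X₂ ⊗ Y₂)).hom =
      ((β_ X₁ X₂).hom ⊗ₘ (β_ Y₁ Y₂).hom) ≫ tensorμ X₂ X₁ Y₂ Y₁ := by
  simp only [BraidedCategory.braiding_tensor_left_hom, BraidedCategory.braiding_tensor_right_hom,
    tensorμ]
  calc
    _ = 𝟙 _ ⊗≫ X₁ ◁ ((β_ X₂ Y₁).hom ≫ (β_ Y₁ X₂).hom) ▷ Y₂ ⊗≫
          (β_ X₁ X₂).hom ▷ (Y₁ ⊗ Y₂) ⊗≫ (X₂ ⊗ X₁) ◁ (β_ Y₁ Y₂).hom ⊗≫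
          X₂ ◁ (β_ X₁ Y₂).hom ▷ Y₁ ⊗≫ 𝟙 _ := by
      monoidal
    _ = _ := by
      rw [h, MonoidalCategory.tensorHom_def]
      monoidal

theorem IsSymmetricBraiding.braiding_braiding {X Y : C} (h : IsSymmetricBraiding X Y) :
    (β_ Y X).hom ≫ (β_ X Y).hom = 𝟙 _ := by
  rw [show (β_ X Y).hom = (β_ Y X).inv from h, Iso.hom_inv_id]

end Braiding

/-! ### Commutativity under duality -/

section Duality

variable {C : Type*} [Category C] [MonoidalCategory C] {H Hd : C} [ExactPairing H Hd]

theorem eq_of_whiskerRight_ev {T : C} {f g : T ⟶ Hd} (h : f ▷ H ≫ ev H Hd = g ▷ H ≫ ev H Hd) :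
    f = g := by
  have key : ∀ k : T ⟶ Hd, (tensorRightHomEquiv T H Hd (𝟙_ C)).symm (k ≫ (λ_ Hd).inv) =
      k ▷ H ≫ ev H Hd := by
    intro k
    change (k ≫ (λ_ Hd).inv) ▷ H ≫ (α_ _ _ _).hom ≫ _ ◁ ev H Hd ≫ (ρ_ _).hom = _
    monoidal
  rw [← cancel_mono (λ_ Hd).inv]
  apply (tensorRightHomEquiv T H Hd (𝟙_ C)).symm.injective
  rw [key, key, h]

theorem eq_of_whiskerLeft_ev {T : C} {f g : T ⟶ H} (h : Hd ◁ f ≫ ev H Hd = Hd ◁ g ≫ ev H Hd) :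
    f = g := by
  have key : ∀ k : T ⟶ H, (tensorLeftHomEquiv T H Hd (𝟙_ C)).symm (k ≫ (ρ_ H).inv) =
      Hd ◁ k ≫ ev H Hd := by
    intro k
    change Hd ◁ (k ≫ (ρ_ H).inv) ≫ (α_ _ _ _).inv ≫ ev H Hd ▷ _ ≫ (λ_ _).hom = _
    monoidal
  rw [← cancel_mono (ρ_ H).inv]
  apply (tensorLeftHomEquiv T H Hd (𝟙_ C)).symm.injective
  rw [key, key, h]

variable [BraidedCategory C]

theorem eq_of_whiskerLeft_evOp {T : C} {f g : T ⟶ Hd}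
    (h : H ◁ f ≫ evOp H Hd = H ◁ g ≫ evOp H Hd) : f = g := by
  apply eq_of_whiskerRight_ev (H := H)
  simpa only [evOp, BraidedCategory.braiding_naturality_right_assoc,
    Iso.cancel_iso_hom_left] using h

/-- The pairing of `H* ⊗ H*` with `H ⊗ H` is nondegenerate on the left: up to the braiding of
`H*` with itself it is the evaluation applied twice. -/
theorem eq_of_whiskerRight_evTwo {T : C} {f g : T ⟶ Hd ⊗ Hd}
    (h : f ▷ (H ⊗ H) ≫ evTwo H Hd = g ▷ (H ⊗ H) ≫ evTwo H Hd) : f = g := by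
  have key : ∀ k : T ⟶ Hd ⊗ Hd, (tensorRightHomEquiv T H Hd Hd).symm k ▷ H ≫ ev H Hd =
      (α_ T H H).hom ≫ (k ≫ (β_ Hd Hd).hom) ▷ (H ⊗ H) ≫ evTwo H Hd := by
    intro k
    rw [comp_whiskerRight, Category.assoc, braiding_evTwo]
    change (k ▷ H ≫ (α_ _ _ _).hom ≫ _ ◁ ev H Hd ≫ (ρ_ _).hom) ▷ H ≫ ev H Hd = _
    monoidal
  rw [← cancel_mono (β_ Hd Hd).inv]
  apply (tensorRightHomEquiv T H Hd Hd).symm.injective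
  apply eq_of_whiskerRight_ev (H := H)
  rw [key, key, comp_whiskerRight, comp_whiskerRight]
  simp only [Category.assoc, ← comp_whiskerRight_assoc, Iso.inv_hom_id, Category.comp_id]
  rw [h]

/-- The pairing of `H* ⊗ H*` with `H ⊗ H` is nondegenerate on the right. -/
theorem eq_of_whiskerLeft_evTwo {T : C} {f g : T ⟶ H ⊗ H}
    (h : (Hd ⊗ Hd) ◁ f ≫ evTwo H Hd = (Hd ⊗ Hd) ◁ g ≫ evTwo H Hd) : f = g := by
  apply (tensorLeftHomEquiv T H Hd H).symm.injective
  apply eq_of_whiskerLeft_ev (Hd := Hd)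
  have key : ∀ k : T ⟶ H ⊗ H, Hd ◁ (tensorLeftHomEquiv T H Hd H).symm k ≫ ev H Hd =
      (α_ Hd Hd T).inv ≫ (β_ Hd Hd).hom ▷ T ≫ (Hd ⊗ Hd) ◁ k ≫ evTwo H Hd := by
    intro k
    rw [← whisker_exchange_assoc, braiding_evTwo]
    change Hd ◁ (Hd ◁ k ≫ (α_ _ _ _).inv ≫ ev H Hd ▷ _ ≫ (λ_ _).hom) ≫ ev H Hd = _
    monoidal
  rw [key, key, h]

variable (H Hd)

/-- Exchanging the two factors on both sides preserves the pairing of `H* ⊗ H*` with `H ⊗ H`.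
This is the only consequence of the symmetry hypothesis needed for the duality between
commutativity and cocommutativity. -/
theorem tensorHom_braiding_evTwo (hsymm : IsSymmetricBraiding H Hd) :
    ((β_ Hd Hd).hom ⊗ₘ (β_ H H).hom) ≫ evTwo H Hd = evTwo H Hd := by
  rw [evTwo, ← Category.assoc, ← tensorμ_braiding _ _ _ _ hsymm.braiding_braiding, Category.assoc,
    ← BraidedCategory.braiding_naturality_assoc]
  simp [← unitors_equal]

theorem isCommutative_dualMul_iff (hsymm : IsSymmetricBraiding H Hd) (d : H ⟶ H ⊗ H) :
    IsCommutative (dualMul Hd d) ↔ IsCocommutative d := by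
  -- Exchanging the factors of `H* ⊗ H*` amounts to exchanging those of `H ⊗ H`.
  have key : ((β_ Hd Hd).hom ≫ dualMul Hd (d ≫ (β_ H H).hom)) ▷ H ≫ ev H Hd =
      dualMul Hd d ▷ H ≫ ev H Hd := by
    rw [comp_whiskerRight, Category.assoc, dualMul_spec, dualMul_spec,
      MonoidalCategory.whiskerLeft_comp, Category.assoc, ← whisker_exchange_assoc,
      ← whisker_exchange_assoc]
    conv_rhs => rw [← tensorHom_braiding_evTwo H Hd hsymm]
    rw [MonoidalCategory.tensorHom_def', Category.assoc]
  have key' := eq_of_whiskerRight_ev key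
  constructor
  · intro h
    apply eq_of_whiskerLeft_evTwo (Hd := Hd)
    rw [← dualMul_spec, ← dualMul_spec]
    congr 2
    rw [← cancel_epi (β_ Hd Hd).hom, key']
    exact h.symm
  · intro h
    rw [show d ≫ (β_ H H).hom = d from h] at key'
    exact key'

theorem isCocommutative_dualComul_iff (hsymm : IsSymmetricBraiding H Hd) (m : H ⊗ H ⟶ H) :
    IsCocommutative (dualComul Hd m) ↔ IsCommutative m := by
  have key : dualComul Hd ((β_ H H).hom ≫ m) ≫ (β_ Hd Hd).hom = dualComul Hd m := by
    apply eq_of_whiskerRight_evTwo (H := H)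
    -- Braiding `H ⊗ H` first completes the braiding of `H* ⊗ H*` to one that the pairing absorbs.
    rw [dualComul_spec, comp_whiskerRight, Category.assoc,
      ← cancel_epi (Hd ◁ (β_ H H).hom), whisker_exchange_assoc,
      ← Category.assoc ((Hd ⊗ Hd) ◁ _), ← MonoidalCategory.tensorHom_def',
      tensorHom_braiding_evTwo H Hd hsymm, dualComul_spec, MonoidalCategory.whiskerLeft_comp,
      Category.assoc]
  constructor
  · intro h
    apply eq_of_whiskerLeft_ev (Hd := Hd)
    rw [← dualComul_spec, ← dualComul_spec]
    congr 2
    rw [← cancel_mono (β_ Hd Hd).hom, key]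
    exact h.symm
  · intro h
    rw [show (β_ H H).hom ≫ m = m from h] at key
    exact key

end Duality

/-! ### Units and counits of `H^op` and `(H^op)*` -/

section Units

variable {C : Type*} [Category C] [MonoidalCategory C] [BraidedCategory C]
variable (H Hd : C) [HopfObj H] [ExactPairing H Hd]

/-- The unit of the algebra `H*`: the transpose of the counit of `H`. -/
noncomputable def dualOne : 𝟙_ C ⟶ Hd :=
  toDual Hd ((λ_ H).hom ≫ ε[H])

/-- The counit of the coalgebra `H*`, and of `(H^op)*`: evaluation at the unit of `H`. -/
noncomputable def dualCounit : Hd ⟶ 𝟙_ C :=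
  (ρ_ Hd).inv ≫ Hd ◁ η[H] ≫ ev H Hd

theorem dualOne_ev : dualOne H Hd ▷ H ≫ ev H Hd = (λ_ H).hom ≫ ε[H] :=
  toDual_spec Hd _

theorem dualOne_evOp : H ◁ dualOne H Hd ≫ evOp H Hd = (ρ_ H).hom ≫ ε[H] := by
  rw [evOp, BraidedCategory.braiding_naturality_right_assoc, dualOne_ev]
  simp

theorem one_ev : Hd ◁ η[H] ≫ ev H Hd = (ρ_ Hd).hom ≫ dualCounit H Hd := by
  simp [dualCounit]

theorem one_evOp : η[H] ▷ Hd ≫ evOp H Hd = (λ_ Hd).hom ≫ dualCounit H Hd := by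
  rw [evOp, BraidedCategory.braiding_naturality_left_assoc]
  simp [dualCounit]

theorem dualOne_dualCounit : dualOne H Hd ≫ dualCounit H Hd = 𝟙 _ := by
  rw [dualCounit, rightUnitor_inv_naturality_assoc, ← whisker_exchange_assoc, dualOne_ev]
  simp [unitors_equal]

theorem dualMul_dualCounit :
    dualMul Hd Δ[H] ≫ dualCounit H Hd =
      (dualCounit H Hd ⊗ₘ dualCounit H Hd) ≫ (λ_ _).hom := by
  have h : dualMul Hd Δ[H] ≫ dualCounit H Hd =
      (ρ_ _).inv ≫ (Hd ⊗ Hd) ◁ η[H] ≫ dualMul Hd Δ[H] ▷ H ≫ ev H Hd := by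
    rw [whisker_exchange_assoc, one_ev]
    simp
  rw [h, dualMul_spec, ← MonoidalCategory.whiskerLeft_comp_assoc, BimonObj.one_comul,
    MonObj.tensorObj.one_def, evTwo, MonoidalCategory.whiskerLeft_comp_assoc,
    tensorμ_natural_right_assoc, MonoidalCategory.tensorHom_comp_tensorHom_assoc, one_ev]
  simp [tensorμ]
  monoidal

theorem one_opMul_right : H ◁ η[H] ≫ opMul H = (ρ_ H).hom := by
  rw [opMul, BraidedCategory.braiding_naturality_right_assoc, MonObj.one_mul]
  simp

theorem one_opMul_left : η[H] ▷ H ≫ opMul H = (λ_ H).hom := by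
  rw [opMul, BraidedCategory.braiding_naturality_left_assoc, MonObj.mul_one]
  simp

theorem opMul_counit : opMul H ≫ ε[H] = (ε[H] ⊗ₘ ε[H]) ≫ (λ_ _).hom := by
  rw [opMul, Category.assoc, Bimon.mul_counit,
    ← BraidedCategory.braiding_naturality_assoc]
  simp [← unitors_equal]

theorem dualOne_dualComul :
    dualOne H Hd ≫ dualComul Hd (opMul H) = (λ_ _).inv ≫ (dualOne H Hd ⊗ₘ dualOne H Hd) := by
  apply eq_of_whiskerRight_evTwo (H := H)
  rw [comp_whiskerRight_assoc, dualComul_spec, ← whisker_exchange_assoc, dualOne_ev,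
    comp_whiskerRight_assoc, evTwo, tensorμ_natural_left_assoc,
    MonoidalCategory.tensorHom_comp_tensorHom_assoc, dualOne_ev,
    MonoidalCategory.leftUnitor_naturality_assoc, opMul_counit]
  simp [tensorμ, MonoidalCategory.tensorHom_def]

/-- Pairing with `h ⊗ 1` applies the counit of `H*` to the second factor. -/
theorem whiskerLeft_one_evTwo :
    (Hd ⊗ Hd) ◁ ((ρ_ H).inv ≫ H ◁ η[H]) ≫ evTwo H Hd =
      (Hd ◁ dualCounit H Hd ≫ (ρ_ Hd).hom) ▷ H ≫ ev H Hd := by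
  -- Naturality of the braiding lets the counit act before the crossing of `H*` with `H`.
  have h := tensorμ_natural (𝟙 Hd) (dualCounit H Hd) (𝟙 H) (𝟙 (𝟙_ C))
  have h' : (𝟙 Hd ⊗ₘ 𝟙 H) ⊗ₘ (dualCounit H Hd ⊗ₘ 𝟙 (𝟙_ C)) =
    (Hd ⊗ H) ◁ (dualCounit H Hd ▷ 𝟙_ C) := by simp
  rw [h'] at h
  rw [MonoidalCategory.whiskerLeft_comp_assoc, evTwo, ← MonoidalCategory.id_tensorHom H,
    tensorμ_natural_right_assoc, MonoidalCategory.tensorHom_comp_tensorHom_assoc, one_ev,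
    MonoidalCategory.whiskerLeft_id, Category.id_comp, ← rightUnitor_naturality,
    MonoidalCategory.tensorHom_def', MonoidalCategory.whiskerLeft_comp, Category.assoc,
    Category.assoc, reassoc_of% h.symm]
  simp [tensorμ]
  monoidal

theorem dualComul_dualCounit :
    dualComul Hd (opMul H) ≫ Hd ◁ dualCounit H Hd = (ρ_ _).inv := by
  rw [← cancel_mono (ρ_ Hd).hom]
  apply eq_of_whiskerRight_ev (H := H)
  have h := (Hd ◁ ((ρ_ H).inv ≫ H ◁ η[H])) ≫= dualComul_spec Hd (opMul H)
  rw [whisker_exchange_assoc, whiskerLeft_one_evTwo, ← comp_whiskerRight_assoc] at h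
  rw [Category.assoc, h, ← MonoidalCategory.whiskerLeft_comp_assoc, Category.assoc, one_opMul_right]
  simp

end Units

/-! ### The mutual actions on units and counits -/

section DoubleCross

variable {C : Type*} [Category C] [MonoidalCategory C] [BraidedCategory C]
variable (H Hd : C) [HopfObj H] [IsIso 𝒮[H]] [ExactPairing H Hd]

theorem antipode_inv_counit : inv 𝒮[H] ≫ ε[H] = ε[H] := by
  rw [IsIso.inv_comp_eq, HopfObj.antipode_counit]

theorem one_antipode_inv : η[H] ≫ inv 𝒮[H] = η[H] := by
  rw [IsIso.comp_inv_eq, HopfObj.one_antipode]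

/-- The map `x ⊗ h ↦ S⁻¹(h₂) (x h₁)`, whose transpose is the left action `H ⊗ B ⟶ B`. -/
noncomputable def adjointMap : H ⊗ H ⟶ H :=
  H ◁ Δ[H] ≫ (α_ H H H).inv ≫ (μ[H] ⊗ₘ inv 𝒮[H]) ≫ opMul H

/-- The map `h ↦ h₂ ⊗ S⁻¹(h₃) h₁`; evaluating its second factor gives the right action
`H ⊗ B ⟶ H`. -/
noncomputable def coadjointMap : H ⟶ H ⊗ H :=
  Δ[H] ≫ (Δ[H] ⊗ₘ inv 𝒮[H]) ≫ (β_ H H).inv ▷ H ≫ (α_ H H H).hom ≫ H ◁ opMul H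

theorem adjointMap_counit : adjointMap H ≫ ε[H] = (ε[H] ⊗ₘ ε[H]) ≫ (λ_ _).hom := by
  have h₁ : (ε[H] ⊗ₘ ε[H]) ≫ (λ_ _).hom = (H ◁ ε[H] ≫ (ρ_ H).hom) ≫ ε[H] := by
    simp [MonoidalCategory.tensorHom_def', unitors_equal]
  have h₂ : H ◁ Δ[H] ≫ (α_ H H H).inv ≫ ((H ◁ ε[H] ≫ (ρ_ H).hom) ⊗ₘ 𝟙 H) = 𝟙 _ := by
    simp only [MonoidalCategory.tensorHom_id, comp_whiskerRight,
      ← associator_inv_naturality_middle_assoc, triangle_assoc_comp_right,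
      ← MonoidalCategory.whiskerLeft_comp, ComonObj.counit_comul_assoc, Iso.inv_hom_id,
      MonoidalCategory.whiskerLeft_id]
  have h₃ : (((ε[H] ⊗ₘ ε[H]) ≫ (λ_ _).hom) ⊗ₘ ε[H]) =
      ((H ◁ ε[H] ≫ (ρ_ H).hom) ⊗ₘ 𝟙 H) ≫ (ε[H] ⊗ₘ ε[H]) := by
    rw [h₁, MonoidalCategory.tensorHom_comp_tensorHom, Category.id_comp]
  simp only [adjointMap, Category.assoc, opMul_counit,
    MonoidalCategory.tensorHom_comp_tensorHom_assoc, antipode_inv_counit, Bimon.mul_counit]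
  rw [h₃, Category.assoc, reassoc_of% h₂]

theorem one_adjointMap : H ◁ η[H] ≫ adjointMap H = (ρ_ _).hom := by
  have h : (α_ H (𝟙_ C) (𝟙_ C)).inv ≫ (H ◁ η[H] ⊗ₘ η[H]) =
      H ◁ (η[H] ⊗ₘ η[H]) ≫ (α_ H H H).inv := by
    rw [← MonoidalCategory.id_tensorHom, ← MonoidalCategory.id_tensorHom,
      associator_inv_naturality]
  rw [adjointMap, ← MonoidalCategory.whiskerLeft_comp_assoc, BimonObj.one_comul,
    MonObj.tensorObj.one_def, MonoidalCategory.whiskerLeft_comp_assoc, ← reassoc_of% h,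
    MonoidalCategory.tensorHom_comp_tensorHom_assoc, MonObj.mul_one, one_antipode_inv,
    MonoidalCategory.tensorHom_def, Category.assoc, one_opMul_right]
  monoidal

theorem coadjointMap_counit : coadjointMap H ≫ H ◁ ε[H] = (ρ_ _).inv := by
  have h₁ : (β_ H H).inv ≫ H ◁ ε[H] ≫ (ρ_ H).hom = ε[H] ▷ H ≫ (λ_ H).hom := by
    simp [← BraidedCategory.braiding_inv_naturality_left_assoc]
  have h₂ : (α_ H H H).hom ≫ H ◁ ((ε[H] ⊗ₘ ε[H]) ≫ (λ_ _).hom) =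
      (H ◁ ε[H] ≫ (ρ_ H).hom) ⊗ₘ ε[H] := by
    rw [MonoidalCategory.tensorHom_def, MonoidalCategory.tensorHom_def]
    monoidal
  simp only [coadjointMap, Category.assoc, opMul_counit, ← MonoidalCategory.whiskerLeft_comp]
  rw [h₂, ← MonoidalCategory.tensorHom_id, MonoidalCategory.tensorHom_comp_tensorHom, h₁,
    MonoidalCategory.tensorHom_comp_tensorHom, ComonObj.counit_comul_assoc, Iso.inv_hom_id,
    Category.id_comp, antipode_inv_counit, MonoidalCategory.id_tensorHom, ComonObj.comul_counit]

theorem one_coadjointMap : η[H] ≫ coadjointMap H = (λ_ _).inv ≫ (η[H] ⊗ₘ η[H]) := by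
  have h₁ : ((λ_ _).inv ≫ (η[H] ⊗ₘ η[H])) ≫ (β_ H H).inv = (λ_ _).inv ≫ (η[H] ⊗ₘ η[H]) := by
    rw [Category.assoc, BraidedCategory.braiding_inv_naturality]
    rw [braiding_inv_tensorUnit_left, ← unitors_equal, Category.assoc, Iso.inv_hom_id_assoc]
  have h₂ : (η[H] ⊗ₘ η[H]) ≫ opMul H = (λ_ _).hom ≫ η[H] := by
    rw [MonoidalCategory.tensorHom_def', Category.assoc, one_opMul_left, leftUnitor_naturality]
  have h₃ : (((λ_ _).inv ≫ (η[H] ⊗ₘ η[H])) ⊗ₘ η[H]) ≫ (α_ H H H).hom =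
      (λ_ _).inv ▷ _ ≫ (α_ _ _ _).hom ≫ (η[H] ⊗ₘ (η[H] ⊗ₘ η[H])) := by
    rw [← associator_naturality, ← Category.id_comp η[H],
      ← MonoidalCategory.tensorHom_comp_tensorHom_assoc]
    simp only [Category.id_comp, MonoidalCategory.tensorHom_id]
  rw [coadjointMap, BimonObj.one_comul_assoc, MonObj.tensorObj.one_def, Category.assoc,
    MonoidalCategory.tensorHom_comp_tensorHom_assoc, one_antipode_inv, BimonObj.one_comul,
    MonObj.tensorObj.one_def, ← MonoidalCategory.tensorHom_id,
    MonoidalCategory.tensorHom_comp_tensorHom_assoc, h₁, Category.comp_id, reassoc_of% h₃,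
    ← MonoidalCategory.id_tensorHom, MonoidalCategory.tensorHom_comp_tensorHom, h₂,
    Category.comp_id]
  simp [MonoidalCategory.tensorHom_def, unitors_inv_equal]

theorem leftAction_evOp : H ◁ leftAction H Hd ≫ evOp H Hd =
      (α_ H H Hd).inv ≫ adjointMap H ▷ Hd ≫ evOp H Hd := toDualOp_spec Hd _

theorem rightAction_eq : rightAction H Hd =
    coadjointMap H ▷ Hd ≫ (α_ H H Hd).hom ≫ H ◁ evOp H Hd ≫ (ρ_ H).hom := by
  simp only [rightAction, coadjointMap, opMul]

theorem dualOne_leftAction :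
    H ◁ dualOne H Hd ≫ leftAction H Hd = (ρ_ H).hom ≫ ε[H] ≫ dualOne H Hd := by
  apply eq_of_whiskerLeft_evOp (H := H)
  have : (α_ H H (𝟙_ C)).inv ≫ (H ⊗ H) ◁ dualOne H Hd =
    H ◁ H ◁ dualOne H Hd ≫ (α_ H H Hd).inv := by simp
  rw [MonoidalCategory.whiskerLeft_comp_assoc, leftAction_evOp, ← reassoc_of% this,
    whisker_exchange_assoc, dualOne_evOp]
  simp [dualOne_evOp, adjointMap_counit]
  simp [MonoidalCategory.tensorHom_def', unitors_equal]

theorem one_leftAction : η[H] ▷ Hd ≫ leftAction H Hd = (λ_ Hd).hom := by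
  apply eq_of_whiskerLeft_evOp (H := H)
  rw [MonoidalCategory.whiskerLeft_comp_assoc, leftAction_evOp]
  rw [associator_inv_naturality_middle_assoc, ← comp_whiskerRight_assoc, one_adjointMap]
  simp

theorem dualOne_rightAction : H ◁ dualOne H Hd ≫ rightAction H Hd = (ρ_ H).hom := by
  rw [rightAction_eq, whisker_exchange_assoc]
  simp only [tensor_whiskerLeft, Category.assoc, Iso.inv_hom_id_assoc,
    ← MonoidalCategory.whiskerLeft_comp_assoc, dualOne_evOp]
  rw [MonoidalCategory.whiskerLeft_comp, Category.assoc, ← rightUnitor_tensor_hom_assoc,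
    rightUnitor_naturality_assoc, reassoc_of% coadjointMap_counit H]
  simp

theorem one_rightAction :
    η[H] ▷ Hd ≫ rightAction H Hd = (λ_ Hd).hom ≫ dualCounit H Hd ≫ η[H] := by
  rw [rightAction_eq, ← comp_whiskerRight_assoc, one_coadjointMap]
  simp only [MonoidalCategory.tensorHom_def', comp_whiskerRight, Category.assoc,
    associator_naturality_left_assoc, ← whisker_exchange_assoc]
  have h : (𝟙_ C ◁ η[H]) ▷ Hd ≫ (α_ (𝟙_ C) H Hd).hom ≫ 𝟙_ C ◁ evOp H Hd =
      (α_ (𝟙_ C) (𝟙_ C) Hd).hom ≫ 𝟙_ C ◁ ((λ_ Hd).hom ≫ dualCounit H Hd) := by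
    rw [← one_evOp]
    monoidal
  rw [reassoc_of% h]
  simp [unitors_inv_equal]

end DoubleCross

/-! ### Commutativity and retracts -/

section Retract

variable {C : Type*} [Category C] [MonoidalCategory C] [BraidedCategory C]

/-- A multiplication obtained from a commutative one by restricting along `i` and projecting
along `p` is commutative; neither map has to be multiplicative. -/
theorem IsCommutative.of_retract {A B : C} {m : A ⊗ A ⟶ A} {n : B ⊗ B ⟶ B}
    (i : B ⟶ A) (p : A ⟶ B) (h : (i ⊗ₘ i) ≫ m ≫ p = n) (hm : IsCommutative m) :
    IsCommutative n := by
  have hm' : (β_ A A).hom ≫ m = m := hm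
  rw [IsCommutative, ← h, ← BraidedCategory.braiding_naturality_assoc, reassoc_of% hm']

theorem IsCocommutative.of_retract {A B : C} {d : A ⟶ A ⊗ A} {c : B ⟶ B ⊗ B}
    (i : B ⟶ A) (p : A ⟶ B) (h : i ≫ d ≫ (p ⊗ₘ p) = c) (hd : IsCocommutative d) :
    IsCocommutative c := by
  have hd' : d ≫ (β_ A A).hom = d := hd
  rw [IsCocommutative, ← h, Category.assoc, Category.assoc,
    BraidedCategory.braiding_naturality, reassoc_of% hd']

end Retract

/-! ### Restrictions of the multiplication of the double to its factors -/

section DoubleCrossUnits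

variable {C : Type*} [Category C] [MonoidalCategory C] [BraidedCategory C]
variable (H Hd : C) [HopfObj H] [IsIso 𝒮[H]] [ExactPairing H Hd]

/-- In `D(H)`, the unit of `B` moves past `H` unchanged: `h ▷ 1 = ε(h) 1` and `h ◁ 1 = h`. -/
theorem dualOne_doubleCross :
    H ◁ dualOne H Hd ≫ doubleCross H Hd = (ρ_ H).hom ≫ (λ_ H).inv ≫ dualOne H Hd ▷ H := by
  have h₁ : H ◁ dualOne H Hd ≫ (Δ[H] ⊗ₘ dualComul Hd (opMul H)) =
      Δ[H] ▷ 𝟙_ C ≫ (H ⊗ H) ◁ (λ_ _).inv ≫ (H ⊗ H) ◁ (dualOne H Hd ⊗ₘ dualOne H Hd) := by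
    rw [MonoidalCategory.tensorHom_def, whisker_exchange_assoc,
      ← MonoidalCategory.whiskerLeft_comp, dualOne_dualComul, MonoidalCategory.whiskerLeft_comp]
  have h₂ : (H ⊗ H) ◁ (λ_ (𝟙_ C)).inv ≫ tensorμ H H (𝟙_ C) (𝟙_ C) ≫
      ((ρ_ H).hom ⊗ₘ (ρ_ H).hom) = (ρ_ _).hom := by
    simp [tensorμ]
    monoidal
  have h₃ : ((ρ_ H).hom ≫ ε[H] ≫ dualOne H Hd) ⊗ₘ (ρ_ H).hom =
      ((ρ_ H).hom ⊗ₘ (ρ_ H).hom) ≫ ε[H] ▷ H ≫ dualOne H Hd ▷ H := by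
    rw [← comp_whiskerRight, ← MonoidalCategory.tensorHom_id,
      MonoidalCategory.tensorHom_comp_tensorHom, Category.comp_id]
  rw [doubleCross, reassoc_of% h₁, tensorμ_natural_right_assoc,
    MonoidalCategory.tensorHom_comp_tensorHom, dualOne_leftAction, dualOne_rightAction, h₃,
    reassoc_of% h₂, rightUnitor_naturality_assoc, ComonObj.counit_comul_assoc]

/-- In `D(H)`, the unit of `H` moves past `B` unchanged: `1 ▷ b = b` and `1 ◁ b = ε(b) 1`. -/
theorem one_doubleCross :
    η[H] ▷ Hd ≫ doubleCross H Hd = (λ_ Hd).hom ≫ (ρ_ Hd).inv ≫ Hd ◁ η[H] := by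
  have h₁ : η[H] ▷ Hd ≫ (Δ[H] ⊗ₘ dualComul Hd (opMul H)) =
      𝟙_ C ◁ dualComul Hd (opMul H) ≫ (λ_ _).inv ▷ (Hd ⊗ Hd) ≫ (η[H] ⊗ₘ η[H]) ▷ (Hd ⊗ Hd) := by
    rw [MonoidalCategory.tensorHom_def', ← whisker_exchange_assoc,
      ← comp_whiskerRight, BimonObj.one_comul, MonObj.tensorObj.one_def, comp_whiskerRight]
  have h₂ : (λ_ (𝟙_ C)).inv ▷ (Hd ⊗ Hd) ≫ tensorμ (𝟙_ C) (𝟙_ C) Hd Hd ≫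
      ((λ_ Hd).hom ⊗ₘ (λ_ Hd).hom) = (λ_ _).hom := by
    simp [tensorμ]
    monoidal
  have h₃ : (λ_ Hd).hom ⊗ₘ ((λ_ Hd).hom ≫ dualCounit H Hd ≫ η[H]) =
      ((λ_ Hd).hom ⊗ₘ (λ_ Hd).hom) ≫ Hd ◁ dualCounit H Hd ≫ Hd ◁ η[H] := by
    rw [← MonoidalCategory.whiskerLeft_comp, ← MonoidalCategory.id_tensorHom,
      MonoidalCategory.tensorHom_comp_tensorHom, Category.comp_id]
  rw [doubleCross, reassoc_of% h₁, tensorμ_natural_left_assoc,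
    MonoidalCategory.tensorHom_comp_tensorHom, one_leftAction, one_rightAction, h₃,
    reassoc_of% h₂, leftUnitor_naturality_assoc, reassoc_of% dualComul_dualCounit H Hd]

/-- The multiplication of `H` is recovered from that of `D(H)` along the inclusion
`h ↦ 1 ⊗ h` and the projection `b ⊗ h ↦ ε(b) h`. -/
theorem doubleMul_proj_right :
    ((λ_ H).inv ≫ dualOne H Hd ▷ H ⊗ₘ (λ_ H).inv ≫ dualOne H Hd ▷ H) ≫ doubleMul H Hd ≫
      dualCounit H Hd ▷ H ≫ (λ_ H).hom = μ[H] := by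
  have h : (dualMul Hd Δ[H] ⊗ₘ μ[H]) ≫ dualCounit H Hd ▷ H ≫ (λ_ H).hom =
      (dualMul Hd Δ[H] ≫ dualCounit H Hd) ▷ (H ⊗ H) ≫ (λ_ _).hom ≫ μ[H] := by
    rw [MonoidalCategory.tensorHom_def, Category.assoc, whisker_exchange_assoc]
    simp only [comp_whiskerRight, leftUnitor_naturality, Category.assoc]
  calc
    _ = 𝟙 _ ⊗≫ dualOne H Hd ▷ (H ⊗ H) ⊗≫ Hd ◁ (H ◁ dualOne H Hd ≫ doubleCross H Hd) ▷ H ⊗≫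
        (dualMul Hd Δ[H] ≫ dualCounit H Hd) ▷ (H ⊗ H) ⊗≫ μ[H] := by
      simp only [doubleMul, Category.assoc, h]
      rw [MonoidalCategory.tensorHom_def]
      monoidal
    _ = 𝟙 _ ⊗≫ dualOne H Hd ▷ (H ⊗ H) ⊗≫ Hd ◁ (dualOne H Hd ≫ dualCounit H Hd) ▷ (H ⊗ H) ⊗≫
        dualCounit H Hd ▷ (H ⊗ H) ⊗≫ μ[H] := by
      rw [dualOne_doubleCross, dualMul_dualCounit, MonoidalCategory.tensorHom_def']
      monoidal
    _ = 𝟙 _ ⊗≫ (dualOne H Hd ▷ (H ⊗ H) ≫ dualCounit H Hd ▷ (H ⊗ H)) ⊗≫ μ[H] := by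
      rw [dualOne_dualCounit]
      monoidal
    _ = _ := by
      rw [← comp_whiskerRight, dualOne_dualCounit]
      monoidal

/-- The multiplication of `B` is recovered from that of `D(H)` along the inclusion
`b ↦ b ⊗ 1` and the projection `b ⊗ h ↦ b ε(h)`. -/
theorem doubleMul_proj_left :
    ((ρ_ Hd).inv ≫ Hd ◁ η[H] ⊗ₘ (ρ_ Hd).inv ≫ Hd ◁ η[H]) ≫ doubleMul H Hd ≫
      Hd ◁ ε[H] ≫ (ρ_ Hd).hom = dualMul Hd Δ[H] := by
  have h : (dualMul Hd Δ[H] ⊗ₘ μ[H]) ≫ Hd ◁ ε[H] ≫ (ρ_ Hd).hom =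
      (Hd ⊗ Hd) ◁ (μ[H] ≫ ε[H]) ≫ (ρ_ _).hom ≫ dualMul Hd Δ[H] := by
    rw [MonoidalCategory.tensorHom_def', Category.assoc, ← whisker_exchange_assoc]
    simp only [MonoidalCategory.whiskerLeft_comp, rightUnitor_naturality, Category.assoc]
  calc
    _ = 𝟙 _ ⊗≫ (Hd ⊗ Hd) ◁ η[H] ⊗≫ Hd ◁ (η[H] ▷ Hd ≫ doubleCross H Hd) ▷ H ⊗≫
        (Hd ⊗ Hd) ◁ (μ[H] ≫ ε[H]) ⊗≫ dualMul Hd Δ[H] := by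
      simp only [doubleMul, Category.assoc, h]
      rw [MonoidalCategory.tensorHom_def']
      monoidal
    _ = 𝟙 _ ⊗≫ (Hd ⊗ Hd) ◁ η[H] ⊗≫ (Hd ⊗ Hd) ◁ (η[H] ≫ ε[H]) ▷ H ⊗≫
        (Hd ⊗ Hd) ◁ ε[H] ⊗≫ dualMul Hd Δ[H] := by
      rw [one_doubleCross, Bimon.mul_counit, MonoidalCategory.tensorHom_def]
      monoidal
    _ = 𝟙 _ ⊗≫ ((Hd ⊗ Hd) ◁ η[H] ≫ (Hd ⊗ Hd) ◁ ε[H]) ⊗≫ dualMul Hd Δ[H] := by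
      rw [BimonObj.one_counit]
      monoidal
    _ = _ := by
      rw [← MonoidalCategory.whiskerLeft_comp, BimonObj.one_counit]
      monoidal

end DoubleCrossUnits

/-! ### The double of a commutative and cocommutative Hopf algebra -/

section Commutative

variable {C : Type*} [Category C] [MonoidalCategory C] [BraidedCategory C]
variable {H : C} (Hd : C) [HopfObj H] [IsIso 𝒮[H]] [ExactPairing H Hd]

/-- The antipode of a commutative Hopf algebra is an involution. -/
theorem inv_antipode_of_isCommutative (h : IsCommutative μ[H]) : inv 𝒮[H] = 𝒮[H] :=
  IsIso.inv_eq_of_hom_inv_id (HopfObj.antipode_antipode H h)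

theorem adjointMap_of_isCommutative (h : IsCommutative μ[H]) :
    adjointMap H = H ◁ ε[H] ≫ (ρ_ H).hom := by
  rw [adjointMap, show opMul H = μ[H] from h, inv_antipode_of_isCommutative h,
    MonoidalCategory.tensorHom_def', Category.assoc, MonObj.mul_assoc]
  calc
    _ = H ◁ (Δ[H] ≫ H ◁ 𝒮[H] ≫ μ[H]) ≫ μ[H] := by
      simp only [tensor_whiskerLeft, Category.assoc, Iso.inv_hom_id_assoc,
        MonoidalCategory.whiskerLeft_comp]
    _ = _ := by
      rw [HopfObj.antipode_right]
      simp

theorem coadjointMap_of_isCommutative (h : IsCommutative μ[H]) (h' : IsCocommutative Δ[H]) :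
    coadjointMap H = (ρ_ H).inv ≫ H ◁ η[H] := by
  have h₁ : Δ[H] ≫ (β_ H H).inv = Δ[H] := by
    rw [Iso.comp_inv_eq]
    exact h'.symm
  rw [coadjointMap, show opMul H = μ[H] from h, inv_antipode_of_isCommutative h,
    MonoidalCategory.tensorHom_def']
  calc
    _ = Δ[H] ≫ H ◁ 𝒮[H] ≫ (Δ[H] ≫ (β_ H H).inv) ▷ H ≫ (α_ H H H).hom ≫ H ◁ μ[H] := by
      simp
    _ = Δ[H] ≫ Δ[H] ▷ H ≫ (α_ H H H).hom ≫ H ◁ (H ◁ 𝒮[H] ≫ μ[H]) := by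
      rw [h₁, whisker_exchange_assoc]
      simp
    _ = Δ[H] ≫ H ◁ (Δ[H] ≫ H ◁ 𝒮[H] ≫ μ[H]) := by
      rw [MonoidalCategory.whiskerLeft_comp _ Δ[H], ComonObj.comul_assoc_assoc]
    _ = _ := by
      rw [HopfObj.antipode_right]
      simp

theorem leftAction_of_isCommutative (h : IsCommutative μ[H]) :
    leftAction H Hd = ε[H] ▷ Hd ≫ (λ_ Hd).hom := by
  apply eq_of_whiskerLeft_evOp (H := H)
  rw [leftAction_evOp, adjointMap_of_isCommutative h]
  simp

theorem rightAction_of_isCommutative (h : IsCommutative μ[H]) (h' : IsCocommutative Δ[H]) :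
    rightAction H Hd = H ◁ dualCounit H Hd ≫ (ρ_ H).hom := by
  rw [rightAction_eq, coadjointMap_of_isCommutative h h', comp_whiskerRight, Category.assoc,
    associator_naturality_middle_assoc, ← MonoidalCategory.whiskerLeft_comp_assoc, one_evOp]
  simp

/-- If `H` is commutative and cocommutative, both actions are trivial, so that `B` and `H` move
past each other by the braiding alone. -/
theorem doubleCross_of_isCommutative (h : IsCommutative μ[H]) (h' : IsCocommutative Δ[H]) :
    doubleCross H Hd = (β_ H Hd).hom := by
  have h₁ : (ε[H] ▷ Hd ≫ (λ_ Hd).hom) ⊗ₘ (H ◁ dualCounit H Hd ≫ (ρ_ H).hom) =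
      ((ε[H] ⊗ₘ 𝟙 Hd) ⊗ₘ (𝟙 H ⊗ₘ dualCounit H Hd)) ≫ ((λ_ Hd).hom ⊗ₘ (ρ_ H).hom) := by
    simp
  rw [doubleCross, leftAction_of_isCommutative Hd h, rightAction_of_isCommutative Hd h h', h₁,
    ← tensorμ_natural_assoc, MonoidalCategory.tensorHom_comp_tensorHom_assoc,
    MonoidalCategory.tensorHom_id, MonoidalCategory.id_tensorHom, ComonObj.counit_comul,
    dualComul_dualCounit]
  simp [tensorμ]
  monoidal

theorem doubleMul_of_isCommutative (h : IsCommutative μ[H]) (h' : IsCocommutative Δ[H]) :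
    doubleMul H Hd = tensorμ Hd H Hd H ≫ (dualMul Hd Δ[H] ⊗ₘ μ[H]) := by
  rw [doubleMul, doubleCross_of_isCommutative Hd h h', tensorμ]
  simp

theorem isCommutative_doubleMul (hsymm : IsSymmetricBraiding H Hd) (h : IsCommutative μ[H])
    (h' : IsCommutative (dualMul Hd Δ[H])) : IsCommutative (doubleMul H Hd) := by
  have hβ := hsymm.braiding_braiding
  -- By symmetry, moving `H` past `H*` is the inverse of moving `H*` past `H`.
  have h₁ : tensorμ Hd H Hd H = tensorδ Hd Hd H H := by
    rw [tensorμ, tensorδ, show (β_ H Hd).hom = (β_ Hd H).inv from hsymm]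
  have h₂ : (β_ (Hd ⊗ H) (Hd ⊗ H)).hom ≫ tensorδ Hd Hd H H =
      tensorδ Hd Hd H H ≫ ((β_ Hd Hd).hom ⊗ₘ (β_ H H).hom) := by
    have := tensorδ Hd Hd H H ≫= tensorμ_braiding Hd Hd H H hβ =≫ tensorδ Hd Hd H H
    simpa using this
  have hm : (β_ H H).hom ≫ μ[H] = μ[H] := h
  have hm' : (β_ Hd Hd).hom ≫ dualMul Hd Δ[H] = dualMul Hd Δ[H] := h'
  rw [IsCommutative,
    doubleMul_of_isCommutative Hd h ((isCommutative_dualMul_iff H Hd hsymm _).1 h'), h₁,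
    reassoc_of% h₂, MonoidalCategory.tensorHom_comp_tensorHom, hm, hm']

end Commutative

/-! ### The comultiplication of the double -/

section DoubleComul

variable {C : Type*} [Category C] [MonoidalCategory C] [BraidedCategory C]
variable {H : C} (Hd : C) [HopfObj H] [ExactPairing H Hd]

/-- The comultiplication of `H` is recovered from that of `D(H)` along `h ↦ 1 ⊗ h` and
`b ⊗ h ↦ ε(b) h`. -/
theorem doubleComul_proj_right :
    (λ_ H).inv ≫ dualOne H Hd ▷ H ≫ doubleComul H Hd ≫
      (dualCounit H Hd ▷ H ≫ (λ_ H).hom ⊗ₘ dualCounit H Hd ▷ H ≫ (λ_ H).hom) = Δ[H] := by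
  rw [← MonoidalCategory.tensorHom_comp_tensorHom, doubleComul, Category.assoc,
    ← tensorμ_natural_left_assoc, MonoidalCategory.tensorHom_def, Category.assoc,
    ← comp_whiskerRight_assoc, dualOne_dualComul, whisker_exchange_assoc,
    ← comp_whiskerRight_assoc, Category.assoc, MonoidalCategory.tensorHom_comp_tensorHom,
    dualOne_dualCounit, ← whisker_exchange_assoc]
  simp [tensorμ]
  monoidal

/-- The comultiplication of `B` is recovered from that of `D(H)` along `b ↦ b ⊗ 1` and
`b ⊗ h ↦ b ε(h)`. -/
theorem doubleComul_proj_left :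
    (ρ_ Hd).inv ≫ Hd ◁ η[H] ≫ doubleComul H Hd ≫
      (Hd ◁ ε[H] ≫ (ρ_ Hd).hom ⊗ₘ Hd ◁ ε[H] ≫ (ρ_ Hd).hom) = dualComul Hd (opMul H) := by
  rw [← MonoidalCategory.tensorHom_comp_tensorHom, doubleComul, Category.assoc,
    ← tensorμ_natural_right_assoc, MonoidalCategory.tensorHom_def', Category.assoc,
    ← MonoidalCategory.whiskerLeft_comp_assoc, BimonObj.one_comul, MonObj.tensorObj.one_def,
    ← whisker_exchange_assoc, ← MonoidalCategory.whiskerLeft_comp_assoc, Category.assoc,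
    MonoidalCategory.tensorHom_comp_tensorHom, BimonObj.one_counit, whisker_exchange_assoc]
  simp [tensorμ]
  monoidal

theorem isCocommutative_doubleComul (hsymm : IsSymmetricBraiding H Hd) (h : IsCocommutative Δ[H])
    (h' : IsCocommutative (dualComul Hd (opMul H))) : IsCocommutative (doubleComul H Hd) := by
  have hβ := hsymm.braiding_braiding
  rw [IsCocommutative, doubleComul, Category.assoc, tensorμ_braiding Hd Hd H H hβ,
    MonoidalCategory.tensorHom_comp_tensorHom_assoc, show Δ[H] ≫ _ = _ from h,
    show dualComul Hd _ ≫ _ = _ from h']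

end DoubleComul

end BraidedDouble

open CategoryTheory MonoidalCategory BraidedDouble MonObj ComonObj HopfObj in
theorem mainTheorem9 {C : Type*} [Category C] [MonoidalCategory C] [BraidedCategory C]
    (H Hd : C) [HopfObj H] [IsIso 𝒮[H]] [ExactPairing H Hd]
    (hsymm : IsSymmetricBraiding H Hd) :
    List.TFAE
      [IsCommutative (doubleMul H Hd),
       IsCommutative μ[H] ∧ IsCommutative (dualMul Hd Δ[H]),
       IsCocommutative Δ[H] ∧ IsCocommutative (dualComul Hd μ[H]),
       IsCocommutative (doubleComul H Hd)] := by
  -- `H` and `H^op` are commutative simultaneously, so `H*` may replace `B = (H^op)*`.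
  have hop : IsCocommutative (dualComul Hd (opMul H)) ↔ IsCocommutative (dualComul Hd μ[H]) := by
    rw [isCocommutative_dualComul_iff H Hd hsymm, isCocommutative_dualComul_iff H Hd hsymm]
    simp only [IsCommutative, opMul, Iso.cancel_iso_hom_left]
  tfae_have 1 → 2 := fun h =>
    ⟨h.of_retract _ _ (doubleMul_proj_right H Hd), h.of_retract _ _ (doubleMul_proj_left H Hd)⟩
  tfae_have 2 → 1 := fun h => isCommutative_doubleMul Hd hsymm h.1 h.2
  tfae_have 2 ↔ 3 := by
    rw [isCommutative_dualMul_iff H Hd hsymm, isCocommutative_dualComul_iff H Hd hsymm, and_comm]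
  tfae_have 3 → 4 := fun h =>
    isCocommutative_doubleComul Hd hsymm h.1 (hop.2 h.2)
  tfae_have 4 → 3 := fun h =>
    ⟨h.of_retract ((λ_ H).inv ≫ dualOne H Hd ▷ H) _ (by simpa using doubleComul_proj_right Hd),
      hop.1 (h.of_retract ((ρ_ Hd).inv ≫ Hd ◁ η[H]) _ (by simpa using doubleComul_proj_left Hd))⟩
  tfae_finish
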